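/- Let $U\subset\mathbb R^n$ be open and convex and let $f\colon U\to\mathbb R$ be convex. A sequence $(x_k)_{k\ge 0}$ in $U$ is called a \emph{BFGS sequence} for $f$ if $f$ is differentiable at every $x_k$ with $\nabla f(x_k)\neq 0$, and there are numbers $0<\mu<\nu<1$ and a (symmetric) positive definite $n\times n$ matrix $H_0$ such that, with \[ s_k=x_{k+1}-x_k,\qquad y_k=\nabla f(x_{k+1})-\nabla f(x_k),\qquad V_k=I-\frac{s_ky_k^T}{s_k^Ty_k},\qquad H_{k+1}=V_kH_kV_k^T+\frac{s_ks_k^T}{s_k^Ty_k}, \] the following hold for all $k=0,1,2,\dots$: $H_k\nabla f(x_k)=-t_ks_k$ for some $t_k\ge 0$; $f(x_{k+1})\le f(x_k)+\mu\nabla f(x_k)^Ts_k$; and $\nabla f(x_{k+1})^Ts_k\ge\nu\nabla f(x_k)^Ts_k$. Let $(x_k)$ be a BFGS sequence for $f$ such that the level set $\{x\in U: f(x)\le f(x_0)\}$ is compact (so that $\min f=\min_U f$ exists). Consider the condition (*) for every $\delta>0$ there are a convex open set $U_\delta\subset U$ containing $\{x\in U:f(x)\le f(x_0)\}$ and a $C^2$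 convex function $f_\delta\colon U_\delta\to\mathbb R$ with $f_\delta(x)=f(x)$ for all $x\in U$ with $\min f+\delta\le f(x)\le f(x_0)$. If $f$ is $C^2$ on $U$, then (*) holds. If (*) holds, then $f$ attains its minimum on $U$ and $f(x_k)\to\min f$ as $k\to\infty$. -/

import Mathlib

open Filter Topology Matrix

noncomputable section

namespace BFGS

/-- The BFGS update of an approximate inverse Hessian `H` by a step `s` and a gradient difference
`y`: with `V = I - s yᵀ / (sᵀ y)`, the new matrix is `V H Vᵀ + s sᵀ / (sᵀ y)`. -/
def update {n : ℕ} (H : Matrix (Fin n) (Fin n) ℝ) (s y : EuclideanSpace ℝ (Fin n)) :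
    Matrix (Fin n) (Fin n) ℝ :=
  (1 - (inner ℝ s y)⁻¹ • vecMulVec s.ofLp y.ofLp) * H *
      (1 - (inner ℝ s y)⁻¹ • vecMulVec s.ofLp y.ofLp)ᵀ +
    (inner ℝ s y)⁻¹ • vecMulVec s.ofLp s.ofLp

/-- The matrices `H₀, H₁, H₂, …` generated from `H₀` by the BFGS update along the points `x k`,
with steps `x (k + 1) - x k` and gradient differences `∇f (x (k + 1)) - ∇f (x k)`. -/
def hessInv {n : ℕ} (f : EuclideanSpace ℝ (Fin n) → ℝ) (x : ℕ → EuclideanSpace ℝ (Fin n))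
    (H₀ : Matrix (Fin n) (Fin n) ℝ) : ℕ → Matrix (Fin n) (Fin n) ℝ
  | 0 => H₀
  | k + 1 => update (hessInv f x H₀ k) (x (k + 1) - x k)
      (gradient f (x (k + 1)) - gradient f (x k))

/-- `x` is a BFGS sequence for `f`. The three properties required at every `k` are the
quasi-Newton direction of the step, the Armijo condition and the weak Wolfe condition. -/
def IsBFGSSequence {n : ℕ} (f : EuclideanSpace ℝ (Fin n) → ℝ)
    (x : ℕ → EuclideanSpace ℝ (Fin n)) : Prop :=
  (∀ k, DifferentiableAt ℝ f (x k) ∧ gradient f (x k) ≠ 0) ∧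
  ∃ (μ ν : ℝ) (H₀ : Matrix (Fin n) (Fin n) ℝ), 0 < μ ∧ μ < ν ∧ ν < 1 ∧ H₀.PosDef ∧
    ∀ k,
      (∃ t : ℝ, 0 ≤ t ∧
        hessInv f x H₀ k *ᵥ (gradient f (x k)).ofLp = -(t • (x (k + 1) - x k).ofLp)) ∧
      f (x (k + 1)) ≤ f (x k) + μ * inner ℝ (gradient f (x k)) (x (k + 1) - x k) ∧
      ν * inner ℝ (gradient f (x k)) (x (k + 1) - x k) ≤
        inner ℝ (gradient f (x (k + 1))) (x (k + 1) - x k)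

/-- For every `δ > 0` there are a convex open neighbourhood `Uδ ⊆ U` of the level set
`{x ∈ U | f x ≤ f x₀}` and a `C²` convex function `fδ` on `Uδ` that agrees with `f` at all
points `x ∈ U` with `min f + δ ≤ f x ≤ f x₀`. Here `min f` is written as the infimum of `f`
over `U`. -/
def SmoothConvexAbove {n : ℕ} (U : Set (EuclideanSpace ℝ (Fin n)))
    (f : EuclideanSpace ℝ (Fin n) → ℝ) (x₀ : EuclideanSpace ℝ (Fin n)) : Prop :=
  ∀ δ : ℝ, 0 < δ →
    ∃ (Uδ : Set (EuclideanSpace ℝ (Fin n))) (fδ : EuclideanSpace ℝ (Fin n) → ℝ),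
      IsOpen Uδ ∧ Convex ℝ Uδ ∧ Uδ ⊆ U ∧ {x ∈ U | f x ≤ f x₀} ⊆ Uδ ∧
      ContDiffOn ℝ 2 fδ Uδ ∧ ConvexOn ℝ Uδ fδ ∧
      ∀ x ∈ U, sInf (f '' U) + δ ≤ f x → f x ≤ f x₀ → fδ x = f x

end BFGS

end

/-!
Let `B k = (H k)⁻¹`. The Byrd–Nocedal potential `tr B - log det B` is nonnegative on positive
definite matrices. Write `g = ∇f (x k)`, and `s`, `y` for the step and the gradient difference.
Since `B k s` is a multiple of `g`, one update raises the potential by at most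
`‖y‖² / sᵀy - 1 - log (‖g‖² sᵀy / (gᵀs)²)`. Condition (*) bounds `‖y‖² / sᵀy` by a constant as long
as `f (x k)` stays away from `min f`. The Armijo condition gives `gᵀs → 0`, and the Wolfe condition
gives `sᵀy ≥ (1 - ν) |gᵀs|`. Hence, if the gradients were bounded away from zero, the logarithm
would tend to infinity and the potential would decrease without bound. So the gradients come
arbitrarily close to zero, which by convexity and boundedness of the level set contradicts
`f (x k)` staying away from `min f`.
-/

namespace BFGS

open scoped InnerProductSpace Gradient

section Sequences

theorem frequently_sub_lt_succ {u : ℕ → ℝ} (hu : BddBelow (Set.range u)) {η : ℝ} (hη : 0 < η) :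
    ∃ᶠ k in atTop, u k - η < u (k + 1) := by
  intro hdecr
  obtain ⟨N, hN⟩ := eventually_atTop.1 hdecr
  obtain ⟨b, hb⟩ := hu
  have hlinear : ∀ j : ℕ, u (N + j) ≤ u N - j * η := by
    intro j
    induction j with
    | zero => simp
    | succ j ih =>
      have hstep := not_lt.1 (hN (N + j) (Nat.le_add_right N j))
      push_cast
      rw [← add_assoc]
      linarith
  obtain ⟨j, hj⟩ := exists_nat_gt ((u N - b) / η)
  rw [div_lt_iff₀ hη] at hj
  linarith [hlinear j, hb ⟨N + j, rfl⟩]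

theorem tendsto_zero_of_sufficient_decrease {u d : ℕ → ℝ} (hu : BddBelow (Set.range u)) {μ : ℝ}
    (hμ : 0 < μ) (hd : ∀ k, d k ≤ 0) (hdecr : ∀ k, u (k + 1) ≤ u k + μ * d k) :
    Tendsto d atTop (𝓝 0) := by
  have hanti : Antitone u := antitone_nat_of_succ_le fun k =>
    (hdecr k).trans (add_le_of_nonpos_right (mul_nonpos_of_nonneg_of_nonpos hμ.le (hd k)))
  have hlim := tendsto_atTop_ciInf hanti hu
  have hdiff : Tendsto (fun k => μ⁻¹ * (u (k + 1) - u k)) atTop (𝓝 0) := by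
    simpa using ((hlim.comp (tendsto_add_atTop_nat 1)).sub hlim).const_mul μ⁻¹
  refine tendsto_of_tendsto_of_tendsto_of_le_of_le hdiff tendsto_const_nhds (fun k => ?_) hd
  rw [inv_mul_le_iff₀ hμ]
  linarith [hdecr k]

end Sequences

theorem isLeast_sInf_image_of_isCompact_sublevel {X : Type*} [TopologicalSpace X] {U : Set X}
    {f : X → ℝ} (hf : ContinuousOn f U) {x₀ : X} (hx₀ : x₀ ∈ U)
    (hlev : IsCompact {z ∈ U | f z ≤ f x₀}) : IsLeast (f '' U) (sInf (f '' U)) := by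
  obtain ⟨z, ⟨hzU, hz₀⟩, hmin⟩ :=
    hlev.exists_isMinOn ⟨x₀, hx₀, le_rfl⟩ (hf.mono (Set.sep_subset _ _))
  have hleast : IsLeast (f '' U) (f z) := by
    refine ⟨⟨z, hzU, rfl⟩, Set.forall_mem_image.2 fun w hw => ?_⟩
    rcases le_total (f w) (f x₀) with hw₀ | hw₀
    · exact hmin ⟨hw, hw₀⟩
    · exact hz₀.trans hw₀
  exact hleast.csInf_eq.symm ▸ hleast

section Convex

variable {E : Type*} [NormedAddCommGroup E]

section NormedSpace

variable [NormedSpace ℝ E] {V : Set E} {g : E → ℝ}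

theorem fderiv_sub_le_of_convexOn (hg : ConvexOn ℝ V g) {a b : E} (ha : a ∈ V) (hb : b ∈ V)
    (hd : DifferentiableAt ℝ g a) : fderiv ℝ g a (b - a) ≤ g b - g a := by
  let line := AffineMap.lineMap (k := ℝ) a b
  have hder : HasDerivAt (g ∘ line) (fderiv ℝ g a (b - a)) 0 := by
    have hd' : HasFDerivAt g (fderiv ℝ g a) (line 0) := by simpa [line] using hd.hasFDerivAt
    exact hd'.comp_hasDerivAt 0 AffineMap.hasDerivAt_lineMap
  simpa [line, slope_def_field] using (hg.comp_affineMap line).le_slope_of_hasDerivAt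
    (by simpa [line] using ha) (by simpa [line] using hb) one_pos hder

theorem differentiableAt_fderiv_of_contDiffOn (hV : IsOpen V) (hg : ContDiffOn ℝ 2 g V) {z : E}
    (hz : z ∈ V) : DifferentiableAt ℝ (fderiv ℝ g) z :=
  ((hg.contDiffAt (hV.mem_nhds hz)).fderiv_right (m := 1) (by norm_num)).differentiableAt
    one_ne_zero

theorem fderiv_fderiv_nonneg_of_convexOn (hV : IsOpen V) (hg : ContDiffOn ℝ 2 g V)
    (hconv : ConvexOn ℝ V g) {z : E} (hz : z ∈ V) (w : E) :
    0 ≤ fderiv ℝ (fderiv ℝ g) z w w := by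
  let line := AffineMap.lineMap (k := ℝ) z (z + w)
  have hline : ∀ r, HasDerivAt line w r := fun r => by
    simpa using AffineMap.hasDerivAt_lineMap (a := z) (b := z + w) (x := r)
  have hopen : IsOpen (line ⁻¹' V) :=
    hV.preimage (continuous_iff_continuousAt.2 fun r => (hline r).continuousAt)
  have h0 : line 0 = z := AffineMap.lineMap_apply_zero z (z + w)
  have hmem : (0 : ℝ) ∈ line ⁻¹' V := by rwa [Set.mem_preimage, h0]
  have hder : ∀ r ∈ line ⁻¹' V, HasDerivAt (g ∘ line) (fderiv ℝ g (line r) w) r := fun r hr =>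
    ((hg.contDiffAt (hV.mem_nhds hr)).differentiableAt two_ne_zero).hasFDerivAt.comp_hasDerivAt
      r (hline r)
  have hmono : MonotoneOn (fun r => fderiv ℝ g (line r) w) (line ⁻¹' V) :=
    ((hconv.comp_affineMap line).monotoneOn_deriv fun r hr =>
      (hder r hr).differentiableAt).congr fun r hr => (hder r hr).deriv
  have hder₂ : HasDerivAt (fun r => fderiv ℝ g (line r) w) (fderiv ℝ (fderiv ℝ g) z w w) 0 := by
    have hdiff := differentiableAt_fderiv_of_contDiffOn hV hg hmem
    simpa [h0] using (hdiff.hasFDerivAt.comp_hasDerivAt 0 (hline 0)).clm_apply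
      (hasDerivAt_const 0 w)
  rw [← hder₂.hasDerivWithinAt.derivWithin (hopen.uniqueDiffWithinAt hmem)]
  exact hmono.derivWithin_nonneg

theorem exists_fderiv_sub_apply_eq (hV : IsOpen V) (hVc : Convex ℝ V) (hg : ContDiffOn ℝ 2 g V)
    {a b : E} (ha : a ∈ V) (hb : b ∈ V) (w : E) :
    ∃ z ∈ segment ℝ a b,
      fderiv ℝ g b w - fderiv ℝ g a w = fderiv ℝ (fderiv ℝ g) z (b - a) w := by
  refine domain_mvt (f := fun p => fderiv ℝ g p w)
    (f' := fun p => (fderiv ℝ (fderiv ℝ g) p).flip w) (fun p hp => ?_) hVc ha hb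
  have hdiff := differentiableAt_fderiv_of_contDiffOn hV hg hp
  simpa using (hdiff.hasFDerivAt.clm_apply (hasFDerivAt_const w p)).hasFDerivWithinAt

end NormedSpace

section InnerProductSpace

variable [InnerProductSpace ℝ E] [CompleteSpace E] {V : Set E} {g : E → ℝ}

theorem sub_le_norm_gradient_mul_dist_of_convexOn (hg : ConvexOn ℝ V g) {a b : E} (ha : a ∈ V)
    (hb : b ∈ V) (hd : DifferentiableAt ℝ g a) : g a - g b ≤ ‖∇ g a‖ * dist a b := by
  have hfirst := fderiv_sub_le_of_convexOn hg ha hb hd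
  calc g a - g b ≤ ⟪∇ g a, a - b⟫_ℝ := by
        rw [← neg_sub b a, inner_neg_right, inner_gradient_left]
        linarith
    _ ≤ ‖∇ g a‖ * dist a b := by
        rw [dist_eq_norm]
        exact real_inner_le_norm _ _

theorem norm_gradient_sub_sq_le_of_convexOn (hV : IsOpen V) (hg : ContDiffOn ℝ 2 g V)
    (hconv : ConvexOn ℝ V g) {M : ℝ} (hM : 0 < M) {a b : E} (ha : a ∈ V) (hb : b ∈ V)
    (hbound : ∀ z ∈ segment ℝ a b, ‖fderiv ℝ (fderiv ℝ g) z‖ ≤ M) :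
    ‖∇ g b - ∇ g a‖ ^ 2 ≤ M * ⟪b - a, ∇ g b - ∇ g a⟫_ℝ := by
  set s := b - a
  set y := ∇ g b - ∇ g a with hy
  -- With `A` the Hessian at an intermediate point, `s = b - a` and `v = y / M`, the inequality
  -- `0 ≤ ⟪A (s - v), s - v⟫` reads `⟪A s, 2 v - s⟫ ≤ ⟪A v, v⟫`; applying the mean value theorem
  -- to the fixed direction `2 v - s` replaces `A s` by `y`.
  set v := M⁻¹ • y with hv
  obtain ⟨z, hz, hmvt⟩ := exists_fderiv_sub_apply_eq hV hconv.1 hg ha hb ((2 : ℝ) • v - s)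
  have hy_apply : ⟪y, (2 : ℝ) • v - s⟫_ℝ = fderiv ℝ (fderiv ℝ g) z s ((2 : ℝ) • v - s) := by
    rw [hy, inner_sub_left, inner_gradient_left, inner_gradient_left, hmvt]
  have hzV : z ∈ V := hconv.1.segment_subset ha hb hz
  have hpos := fderiv_fderiv_nonneg_of_convexOn hV hg hconv hzV (s - v)
  have hsymm : fderiv ℝ (fderiv ℝ g) z v s = fderiv ℝ (fderiv ℝ g) z s v :=
    (hg.contDiffAt (hV.mem_nhds hzV)).isSymmSndFDerivAt (by simp) v s
  have hvv : fderiv ℝ (fderiv ℝ g) z v v ≤ M⁻¹ * ‖y‖ ^ 2 := calc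
    _ ≤ ‖fderiv ℝ (fderiv ℝ g) z‖ * ‖v‖ * ‖v‖ :=
      (Real.le_norm_self _).trans (ContinuousLinearMap.le_opNorm₂ _ _ _)
    _ ≤ M * ‖v‖ * ‖v‖ := by gcongr; exact hbound z hz
    _ = M⁻¹ * ‖y‖ ^ 2 := by
      rw [hv, norm_smul, norm_inv, Real.norm_of_nonneg hM.le]
      field_simp
  have hkey : ⟪y, (2 : ℝ) • v - s⟫_ℝ ≤ M⁻¹ * ‖y‖ ^ 2 := by
    simp only [hy_apply, map_sub, map_smul, _root_.sub_apply, smul_eq_mul, hsymm] at hpos ⊢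
    linarith
  rw [inner_sub_right, hv, inner_smul_right, inner_smul_right, real_inner_self_eq_norm_sq,
    real_inner_comm] at hkey
  rw [← inv_mul_le_iff₀ hM]
  linarith

theorem exists_norm_gradient_sub_sq_le_of_isCompact (hV : IsOpen V) (hg : ContDiffOn ℝ 2 g V)
    (hconv : ConvexOn ℝ V g) {K : Set E} (hK : IsCompact K) (hKc : Convex ℝ K) (hKV : K ⊆ V) :
    ∃ M, ∀ a ∈ K, ∀ b ∈ K, ‖∇ g b - ∇ g a‖ ^ 2 ≤ M * ⟪b - a, ∇ g b - ∇ g a⟫_ℝ := by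
  have hcont : ContinuousOn (fun z => ‖fderiv ℝ (fderiv ℝ g) z‖) V :=
    ((hg.fderiv_of_isOpen hV (m := 1) (by norm_num)).continuousOn_fderiv_of_isOpen hV le_rfl).norm
  obtain ⟨C, hC⟩ := hK.bddAbove_image (hcont.mono hKV)
  exact ⟨max C 1, fun a ha b hb => norm_gradient_sub_sq_le_of_convexOn hV hg hconv
    (lt_max_of_lt_right one_pos) (hKV ha) (hKV hb) fun z hz =>
      le_max_of_le_left (hC ⟨z, hKc.segment_subset ha hb hz, rfl⟩)⟩

theorem gradient_eq_of_eqOn_levels (hV : IsOpen V) {f : E → ℝ} (hf : ContinuousOn f V) {α β : ℝ}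
    (hgf : ∀ z ∈ V, α ≤ f z → f z ≤ β → g z = f z) {a : E} (ha : a ∈ V) (hα : α < f a)
    (hβ : f a < β) : ∇ g a = ∇ f a := by
  have hfa := hf.continuousAt (hV.mem_nhds ha)
  refine EventuallyEq.gradient_eq ?_
  filter_upwards [hV.mem_nhds ha, hfa.eventually_const_lt hα, hfa.eventually_lt_const hβ] with
    z hz hzα hzβ using hgf z hz hzα.le hzβ.le

end InnerProductSpace

end Convex

section DualUpdate

variable {ι K : Type*} [Fintype ι] [Field K]

theorem det_one_add_vecMulVec {R : Type*} [CommRing R] [DecidableEq ι] (u v : ι → R) :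
    (1 + vecMulVec u v).det = 1 + v ⬝ᵥ u := by
  rw [vecMulVec_eq Unit, det_one_add_replicateCol_mul_replicateRow]

/-- The BFGS update of the approximate Hessian `B = H⁻¹`, dual to `update`. -/
def dualUpdate (B : Matrix ι ι K) (s y : ι → K) : Matrix ι ι K :=
  B - (s ⬝ᵥ B *ᵥ s)⁻¹ • vecMulVec (B *ᵥ s) (B *ᵥ s) + (s ⬝ᵥ y)⁻¹ • vecMulVec y y

theorem dualUpdate_mulVec {B : Matrix ι ι K} {s y : ι → K} (hsy : s ⬝ᵥ y ≠ 0)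
    (hsB : s ⬝ᵥ B *ᵥ s ≠ 0) : dualUpdate B s y *ᵥ s = y := by
  simp [dualUpdate, add_mulVec, sub_mulVec, smul_mulVec, vecMulVec_mulVec, smul_smul,
    dotProduct_comm _ s, hsy, hsB]

theorem isSymm_dualUpdate {B : Matrix ι ι K} (hB : B.IsSymm) (s y : ι → K) :
    (dualUpdate B s y).IsSymm := by
  simp [dualUpdate, IsSymm, transpose_vecMulVec, hB.eq]

theorem trace_dualUpdate (B : Matrix ι ι K) (s y : ι → K) :
    (dualUpdate B s y).trace =
      B.trace - ((B *ᵥ s) ⬝ᵥ (B *ᵥ s)) / (s ⬝ᵥ B *ᵥ s) + (y ⬝ᵥ y) / (s ⬝ᵥ y) := by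
  simp [dualUpdate, trace_add, trace_sub, trace_smul, trace_vecMulVec, div_eq_inv_mul]

theorem vecMul_eq_mulVec_of_isSymm {B : Matrix ι ι K} (hB : B.IsSymm) (v : ι → K) :
    v ᵥ* B = B *ᵥ v := by
  rw [← mulVec_transpose, hB.eq]

-- With `C = B + a⁻¹ (y - B s) (B s)ᵀ` and `a = sᵀ B s`, the matrix `dualUpdate B s y` arises from
-- `B` by two rank-one changes: `C = (1 + a⁻¹ (y - B s) sᵀ) B` has determinant
-- `det B * (sᵀ y / a)`, and since `C s = y`, the remaining change
-- `y ((sᵀ y)⁻¹ y - a⁻¹ B s)ᵀ = C s ((sᵀ y)⁻¹ y - a⁻¹ B s)ᵀ` leaves the determinant unchanged.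
theorem det_dualUpdate [DecidableEq ι] {B : Matrix ι ι K} (hB : B.IsSymm) {s y : ι → K}
    (hsy : s ⬝ᵥ y ≠ 0) (hsB : s ⬝ᵥ B *ᵥ s ≠ 0) :
    (dualUpdate B s y).det = B.det * ((s ⬝ᵥ y) / (s ⬝ᵥ B *ᵥ s)) := by
  set u := B *ᵥ s with hu
  set a := s ⬝ᵥ u with ha
  set ρ := s ⬝ᵥ y with hρ
  set C := (1 + vecMulVec (a⁻¹ • (y - u)) s) * B with hC
  set w := ρ⁻¹ • y - a⁻¹ • u
  have hC_eq : C = B + a⁻¹ • vecMulVec (y - u) u := by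
    rw [hC, add_mul, one_mul, vecMulVec_mul, vecMul_eq_mulVec_of_isSymm hB, smul_vecMulVec]
  have hCs : C *ᵥ s = y := by
    simp [hC_eq, add_mulVec, smul_mulVec, vecMulVec_mulVec, smul_smul, dotProduct_comm u s, ← ha,
      ← hu, hsB]
  have hfactor : dualUpdate B s y = C * (1 + vecMulVec s w) := by
    rw [mul_add, mul_one, mul_vecMulVec, hCs, hC_eq, dualUpdate, ← hu, ← ha, ← hρ, vecMulVec_sub,
      vecMulVec_smul, vecMulVec_smul, sub_vecMulVec, smul_sub]
    abel
  have hws : w ⬝ᵥ s = 0 := by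
    simp [w, dotProduct_comm _ s, ← ha, ← hρ, hsy, hsB]
  have hdetC : C.det = B.det * (ρ / a) := by
    rw [hC, det_mul, det_one_add_vecMulVec, dotProduct_smul, dotProduct_sub, ← ha, ← hρ,
      smul_eq_mul]
    field_simp
    ring
  rw [hfactor, det_mul, det_one_add_vecMulVec, hws, add_zero, mul_one, hdetC]

end DualUpdate

section Potential

variable {ι : Type*} [Fintype ι] [DecidableEq ι]

/-- The Byrd–Nocedal potential of an approximate Hessian, which controls both ends of its
spectrum: each eigenvalue `l` contributes `l - log l`. -/
noncomputable def potential (B : Matrix ι ι ℝ) : ℝ :=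
  B.trace - Real.log B.det

theorem potential_nonneg {B : Matrix ι ι ℝ} (hB : B.PosDef) : 0 ≤ potential B := by
  have hsum : potential B = ∑ i, (hB.isHermitian.eigenvalues i -
      Real.log (hB.isHermitian.eigenvalues i)) := by
    rw [potential, hB.isHermitian.det_eq_prod_eigenvalues, hB.isHermitian.trace_eq_sum_eigenvalues,
      Finset.sum_sub_distrib]
    simp only [RCLike.ofReal_real_eq_id, id_eq]
    rw [Real.log_prod fun i _ => (hB.eigenvalues_pos i).ne']
  rw [hsum]
  exact Finset.sum_nonneg fun i _ => by
    linarith [Real.log_le_sub_one_of_pos (hB.eigenvalues_pos i)]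

theorem potential_dualUpdate_le {B : Matrix ι ι ℝ} (hB : B.PosDef) {s y : ι → ℝ}
    (hsy : 0 < s ⬝ᵥ y) :
    potential (dualUpdate B s y) ≤ potential B + (y ⬝ᵥ y) / (s ⬝ᵥ y) - 1 -
      Real.log (((B *ᵥ s) ⬝ᵥ (B *ᵥ s)) * (s ⬝ᵥ y) / (s ⬝ᵥ B *ᵥ s) ^ 2) := by
  have hs : s ≠ 0 := by rintro rfl; simp at hsy
  have hsB : 0 < s ⬝ᵥ B *ᵥ s := by simpa using hB.dotProduct_mulVec_pos hs
  have hBs : 0 < (B *ᵥ s) ⬝ᵥ (B *ᵥ s) := by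
    have hBs_ne : B *ᵥ s ≠ 0 := fun h => by simp [h] at hsB
    simpa using dotProduct_star_self_pos_iff.2 hBs_ne
  have hquot : 0 < ((B *ᵥ s) ⬝ᵥ (B *ᵥ s)) / (s ⬝ᵥ B *ᵥ s) := div_pos hBs hsB
  have hratio : 0 < (s ⬝ᵥ y) / (s ⬝ᵥ B *ᵥ s) := div_pos hsy hsB
  have hlog : Real.log (((B *ᵥ s) ⬝ᵥ (B *ᵥ s)) * (s ⬝ᵥ y) / (s ⬝ᵥ B *ᵥ s) ^ 2) =
      Real.log (((B *ᵥ s) ⬝ᵥ (B *ᵥ s)) / (s ⬝ᵥ B *ᵥ s)) +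
        Real.log ((s ⬝ᵥ y) / (s ⬝ᵥ B *ᵥ s)) := by
    rw [← Real.log_mul hquot.ne' hratio.ne', div_mul_div_comm, sq]
  rw [hlog, potential, trace_dualUpdate,
    det_dualUpdate (isHermitian_iff_isSymm.1 hB.isHermitian) hsy.ne' hsB.ne',
    Real.log_mul hB.det_pos.ne' hratio.ne', potential]
  linarith [Real.log_le_sub_one_of_pos hquot]

end Potential

section Update

variable {n : ℕ}

theorem inner_eq_dotProduct (u v : EuclideanSpace ℝ (Fin n)) : ⟪u, v⟫_ℝ = u.ofLp ⬝ᵥ v.ofLp := by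
  rw [EuclideanSpace.inner_eq_star_dotProduct, star_trivial, dotProduct_comm]

theorem norm_sq_eq_dotProduct (u : EuclideanSpace ℝ (Fin n)) : ‖u‖ ^ 2 = u.ofLp ⬝ᵥ u.ofLp := by
  rw [← real_inner_self_eq_norm_sq, inner_eq_dotProduct]

theorem posDef_update {H : Matrix (Fin n) (Fin n) ℝ} (hH : H.PosDef)
    {s y : EuclideanSpace ℝ (Fin n)} (hsy : 0 < ⟪s, y⟫_ℝ) : (update H s y).PosDef := by
  set V : Matrix (Fin n) (Fin n) ℝ := 1 - (⟪s, y⟫_ℝ)⁻¹ • vecMulVec s.ofLp y.ofLp with hV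
  have hVHV : (V * H * Vᵀ).PosSemidef := by
    simpa using hH.posSemidef.mul_mul_conjTranspose_same V
  have hss : ((⟪s, y⟫_ℝ)⁻¹ • vecMulVec s.ofLp s.ofLp).PosSemidef := by
    simpa using (posSemidef_vecMulVec_self_star s.ofLp).smul (inv_nonneg.2 hsy.le)
  refine .of_dotProduct_mulVec_pos (hVHV.add hss).isHermitian fun w hw => ?_
  have hform : star w ⬝ᵥ update H s y *ᵥ w =
      (Vᵀ *ᵥ w) ⬝ᵥ H *ᵥ (Vᵀ *ᵥ w) + (⟪s, y⟫_ℝ)⁻¹ * (s.ofLp ⬝ᵥ w) ^ 2 := by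
    rw [update, ← hV, star_trivial, add_mulVec, dotProduct_add, ← mulVec_mulVec, ← mulVec_mulVec,
      dotProduct_mulVec, ← mulVec_transpose, smul_mulVec, vecMulVec_mulVec, op_smul_eq_smul,
      dotProduct_smul, dotProduct_smul, dotProduct_comm w, smul_eq_mul, smul_eq_mul, sq]
  rw [hform]
  by_cases hs : s.ofLp ⬝ᵥ w = 0
  · have hVw : Vᵀ *ᵥ w = w := by
      simp [hV, sub_mulVec, smul_mulVec, vecMulVec_mulVec, transpose_vecMulVec, hs]
    rw [hVw, hs]
    simpa using hH.dotProduct_mulVec_pos hw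
  · have hnonneg : 0 ≤ (Vᵀ *ᵥ w) ⬝ᵥ H *ᵥ (Vᵀ *ᵥ w) := by
      simpa using hH.posSemidef.dotProduct_mulVec_nonneg (Vᵀ *ᵥ w)
    exact add_pos_of_nonneg_of_pos hnonneg (mul_pos (inv_pos.2 hsy) (sq_pos_of_ne_zero hs))

theorem update_mul_dualUpdate {H B : Matrix (Fin n) (Fin n) ℝ} (hB : B.IsSymm) (hHB : H * B = 1)
    {s y : EuclideanSpace ℝ (Fin n)} (hsy : s.ofLp ⬝ᵥ y.ofLp ≠ 0)
    (hsB : s.ofLp ⬝ᵥ B *ᵥ s.ofLp ≠ 0) :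
    update H s y * dualUpdate B s.ofLp y.ofLp = 1 := by
  set ρ := s.ofLp ⬝ᵥ y.ofLp with hρ
  set u := B *ᵥ s.ofLp with hu
  set a := s.ofLp ⬝ᵥ u
  set V : Matrix (Fin n) (Fin n) ℝ := 1 - ρ⁻¹ • vecMulVec s.ofLp y.ofLp with hV
  have hsecant : s.ofLp ᵥ* dualUpdate B s.ofLp y.ofLp = y.ofLp := by
    rw [vecMul_eq_mulVec_of_isSymm (isSymm_dualUpdate hB _ _), dualUpdate_mulVec hsy hsB]
  have hVB : Vᵀ * dualUpdate B s.ofLp y.ofLp = B - a⁻¹ • vecMulVec u u := by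
    rw [hV, transpose_sub, transpose_one, transpose_smul, transpose_vecMulVec, sub_mul, one_mul,
      smul_mul, vecMulVec_mul, hsecant, dualUpdate, add_sub_cancel_right]
  have hHu : H *ᵥ u = s.ofLp := by rw [hu, mulVec_mulVec, hHB, one_mulVec]
  have hVs : V *ᵥ s.ofLp = 0 := by
    simp [hV, sub_mulVec, smul_mulVec, vecMulVec_mulVec, smul_smul, dotProduct_comm y.ofLp, ← hρ,
      hsy]
  calc update H s y * dualUpdate B s.ofLp y.ofLp
      = V * (H * (Vᵀ * dualUpdate B s.ofLp y.ofLp)) +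
          ρ⁻¹ • vecMulVec s.ofLp (s.ofLp ᵥ* dualUpdate B s.ofLp y.ofLp) := by
        rw [update, inner_eq_dotProduct, ← hρ, ← hV, add_mul, smul_mul, vecMulVec_mul, mul_assoc,
          mul_assoc]
    _ = V * (1 - a⁻¹ • vecMulVec s.ofLp u) + ρ⁻¹ • vecMulVec s.ofLp y.ofLp := by
        rw [hVB, hsecant, mul_sub, hHB, Matrix.mul_smul, mul_vecMulVec, hHu]
    _ = V + ρ⁻¹ • vecMulVec s.ofLp y.ofLp := by
        rw [mul_sub, mul_one, Matrix.mul_smul, mul_vecMulVec, hVs, zero_vecMulVec,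
          smul_zero, sub_zero]
    _ = 1 := sub_add_cancel _ _

theorem inv_update {H : Matrix (Fin n) (Fin n) ℝ} (hH : H.PosDef)
    {s y : EuclideanSpace ℝ (Fin n)} (hsy : 0 < ⟪s, y⟫_ℝ) :
    (update H s y)⁻¹ = dualUpdate H⁻¹ s.ofLp y.ofLp := by
  have hs : s.ofLp ≠ 0 := fun hs => by simp [inner_eq_dotProduct, hs] at hsy
  have hsB : 0 < s.ofLp ⬝ᵥ H⁻¹ *ᵥ s.ofLp := by simpa using hH.inv.dotProduct_mulVec_pos hs
  rw [inner_eq_dotProduct] at hsy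
  exact inv_eq_right_inv (update_mul_dualUpdate (isHermitian_iff_isSymm.1 hH.inv.isHermitian)
    (mul_nonsing_inv _ hH.det_pos.ne'.isUnit) hsy.ne' hsB.ne')

theorem potential_inv_update_le {H : Matrix (Fin n) (Fin n) ℝ} (hH : H.PosDef)
    {g s y : EuclideanSpace ℝ (Fin n)} (hsy : 0 < ⟪s, y⟫_ℝ) {t : ℝ} (ht : t ≠ 0)
    (hstep : H *ᵥ g.ofLp = -(t • s.ofLp)) :
    potential (update H s y)⁻¹ ≤ potential H⁻¹ + ‖y‖ ^ 2 / ⟪s, y⟫_ℝ - 1 -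
      Real.log (‖g‖ ^ 2 * ⟪s, y⟫_ℝ / ⟪g, s⟫_ℝ ^ 2) := by
  have hBs : H⁻¹ *ᵥ s.ofLp = -(t⁻¹ • g.ofLp) := by
    have hg : g.ofLp = -(t • H⁻¹ *ᵥ s.ofLp) := by
      rw [← mulVec_smul, ← mulVec_neg, ← hstep, mulVec_mulVec,
        nonsing_inv_mul _ hH.det_pos.ne'.isUnit, one_mulVec]
    rw [hg, smul_neg, neg_neg, inv_smul_smul₀ ht]
  have hle := potential_dualUpdate_le hH.inv (inner_eq_dotProduct s y ▸ hsy)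
  have hscale :
      ((H⁻¹ *ᵥ s.ofLp) ⬝ᵥ (H⁻¹ *ᵥ s.ofLp)) * ⟪s, y⟫_ℝ / (s.ofLp ⬝ᵥ H⁻¹ *ᵥ s.ofLp) ^ 2 =
        ‖g‖ ^ 2 * ⟪s, y⟫_ℝ / ⟪g, s⟫_ℝ ^ 2 := by
    rw [hBs, neg_dotProduct_neg, dotProduct_neg, smul_dotProduct, dotProduct_smul, dotProduct_smul,
      ← norm_sq_eq_dotProduct, ← inner_eq_dotProduct, real_inner_comm g s]
    simp only [smul_eq_mul]
    field_simp
  rwa [inv_update hH hsy, ← hscale, norm_sq_eq_dotProduct, inner_eq_dotProduct s y]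

end Update

section WolfeRun

variable {n : ℕ}

theorem step_pos_and_inner_neg {H : Matrix (Fin n) (Fin n) ℝ} (hH : H.PosDef)
    {g s : EuclideanSpace ℝ (Fin n)} (hg : g ≠ 0) {t : ℝ} (ht : 0 ≤ t)
    (hstep : H *ᵥ g.ofLp = -(t • s.ofLp)) : 0 < t ∧ ⟪g, s⟫_ℝ < 0 := by
  have hpos : 0 < g.ofLp ⬝ᵥ H *ᵥ g.ofLp := by
    simpa using hH.dotProduct_mulVec_pos ((WithLp.ofLp_eq_zero 2).not.2 hg)
  rw [hstep, dotProduct_neg, dotProduct_smul, ← inner_eq_dotProduct, smul_eq_mul,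
    ← mul_neg] at hpos
  have hinner := pos_of_mul_pos_right hpos ht
  exact ⟨pos_of_mul_pos_left hpos hinner.le, neg_pos.1 hinner⟩

/-- A BFGS run with the weak Wolfe condition of parameter `ν`, recorded by its matrices `H k`, the
gradients `g k` and the steps `s k`. The objective function is left out, as the evolution of the
matrices depends on it only through `g`. -/
structure IsWolfeRun (ν : ℝ) (H : ℕ → Matrix (Fin n) (Fin n) ℝ)
    (g s : ℕ → EuclideanSpace ℝ (Fin n)) : Prop where
  lt_one : ν < 1
  posDef_zero : (H 0).PosDef
  update_succ : ∀ k, H (k + 1) = update (H k) (s k) (g (k + 1) - g k)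
  ne_zero : ∀ k, g k ≠ 0
  exists_step : ∀ k, ∃ t : ℝ, 0 ≤ t ∧ H k *ᵥ (g k).ofLp = -(t • (s k).ofLp)
  wolfe : ∀ k, ν * ⟪g k, s k⟫_ℝ ≤ ⟪g (k + 1), s k⟫_ℝ

namespace IsWolfeRun

variable {ν : ℝ} {H : ℕ → Matrix (Fin n) (Fin n) ℝ} {g s : ℕ → EuclideanSpace ℝ (Fin n)}

theorem curvature (h : IsWolfeRun ν H g s) (k : ℕ) :
    (1 - ν) * -⟪g k, s k⟫_ℝ ≤ ⟪s k, g (k + 1) - g k⟫_ℝ := by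
  rw [inner_sub_right, real_inner_comm (g (k + 1)), real_inner_comm (g k)]
  linarith [h.wolfe k]

theorem inner_sub_pos (h : IsWolfeRun ν H g s) {k : ℕ} (hneg : ⟪g k, s k⟫_ℝ < 0) :
    0 < ⟪s k, g (k + 1) - g k⟫_ℝ :=
  (mul_pos (sub_pos.2 h.lt_one) (neg_pos.2 hneg)).trans_le (h.curvature k)

theorem posDef (h : IsWolfeRun ν H g s) (k : ℕ) : (H k).PosDef := by
  induction k with
  | zero => exact h.posDef_zero
  | succ k ih =>
    obtain ⟨t, ht, hstep⟩ := h.exists_step k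
    rw [h.update_succ]
    exact posDef_update ih (h.inner_sub_pos (step_pos_and_inner_neg ih (h.ne_zero k) ht hstep).2)

theorem inner_neg (h : IsWolfeRun ν H g s) (k : ℕ) : ⟪g k, s k⟫_ℝ < 0 := by
  obtain ⟨t, ht, hstep⟩ := h.exists_step k
  exact (step_pos_and_inner_neg (h.posDef k) (h.ne_zero k) ht hstep).2

theorem potential_succ_le (h : IsWolfeRun ν H g s) {M : ℝ} {k : ℕ}
    (hM : ‖g (k + 1) - g k‖ ^ 2 ≤ M * ⟪s k, g (k + 1) - g k⟫_ℝ) :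
    potential (H (k + 1))⁻¹ ≤ potential (H k)⁻¹ + M - 1 -
      Real.log (‖g k‖ ^ 2 * ⟪s k, g (k + 1) - g k⟫_ℝ / ⟪g k, s k⟫_ℝ ^ 2) := by
  obtain ⟨t, ht, hstep⟩ := h.exists_step k
  have ht₀ := (step_pos_and_inner_neg (h.posDef k) (h.ne_zero k) ht hstep).1
  have hsy := h.inner_sub_pos (h.inner_neg k)
  have hle := potential_inv_update_le (h.posDef k) hsy ht₀.ne' hstep
  rw [h.update_succ]
  linarith [(div_le_iff₀ hsy).2 hM]

theorem le_log_of_neg_inner_le (h : IsWolfeRun ν H g s) {M c : ℝ} (hc : 0 ≤ c) {k : ℕ}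
    (hg : c ≤ ‖g k‖) (hsmall : -⟪g k, s k⟫_ℝ ≤ (1 - ν) * c ^ 2 / Real.exp M) :
    M ≤ Real.log (‖g k‖ ^ 2 * ⟪s k, g (k + 1) - g k⟫_ℝ / ⟪g k, s k⟫_ℝ ^ 2) := by
  have hν : 0 ≤ 1 - ν := (sub_pos.2 h.lt_one).le
  have hpos : 0 < -⟪g k, s k⟫_ℝ := neg_pos.2 (h.inner_neg k)
  have hexp : Real.exp M ≤ ‖g k‖ ^ 2 * ⟪s k, g (k + 1) - g k⟫_ℝ / ⟪g k, s k⟫_ℝ ^ 2 := by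
    rw [le_div_iff₀ (pow_pos hpos 2 |>.trans_eq (neg_sq _))]
    calc Real.exp M * ⟪g k, s k⟫_ℝ ^ 2
        = -⟪g k, s k⟫_ℝ * Real.exp M * -⟪g k, s k⟫_ℝ := by ring
      _ ≤ (1 - ν) * c ^ 2 * -⟪g k, s k⟫_ℝ := by
        exact mul_le_mul_of_nonneg_right ((le_div_iff₀ (Real.exp_pos M)).1 hsmall) hpos.le
      _ = c ^ 2 * ((1 - ν) * -⟪g k, s k⟫_ℝ) := by ring
      _ ≤ ‖g k‖ ^ 2 * ⟪s k, g (k + 1) - g k⟫_ℝ := by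
        gcongr
        exact h.curvature k
  exact (Real.le_log_iff_exp_le ((Real.exp_pos M).trans_le hexp)).2 hexp

theorem frequently_norm_lt (h : IsWolfeRun ν H g s)
    (hlim : Tendsto (fun k => ⟪g k, s k⟫_ℝ) atTop (𝓝 0)) {M : ℝ}
    (hM : ∀ᶠ k in atTop, ‖g (k + 1) - g k‖ ^ 2 ≤ M * ⟪s k, g (k + 1) - g k⟫_ℝ) {c : ℝ}
    (hc : 0 < c) : ∃ᶠ k in atTop, ‖g k‖ < c := by
  intro hfar
  have hη : 0 < (1 - ν) * c ^ 2 / Real.exp M :=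
    div_pos (mul_pos (sub_pos.2 h.lt_one) (pow_pos hc 2)) (Real.exp_pos M)
  have hsmall : ∀ᶠ k in atTop, -⟪g k, s k⟫_ℝ < (1 - ν) * c ^ 2 / Real.exp M :=
    hlim.neg.eventually_lt_const (by rwa [neg_zero])
  have hbdd : BddBelow (Set.range fun k => potential (H k)⁻¹) :=
    ⟨0, Set.forall_mem_range.2 fun k => potential_nonneg (h.posDef k).inv⟩
  refine frequently_sub_lt_succ hbdd one_pos ?_
  filter_upwards [hM, hfar, hsmall] with k hMk hck hsk
  linarith [h.potential_succ_le hMk, h.le_log_of_neg_inner_le hc.le (not_lt.1 hck) hsk.le]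

end IsWolfeRun

end WolfeRun

section BFGSSequence

variable {n : ℕ} {U : Set (EuclideanSpace ℝ (Fin n))} {f : EuclideanSpace ℝ (Fin n) → ℝ}

theorem SmoothConvexAbove.exists_norm_gradient_sub_sq_le {x₀ : EuclideanSpace ℝ (Fin n)}
    (hsm : SmoothConvexAbove U f x₀) (hU : IsOpen U) (hf : ConvexOn ℝ U f)
    (hlev : IsCompact {z ∈ U | f z ≤ f x₀}) {δ : ℝ} (hδ : 0 < δ) :
    ∃ M, ∀ a ∈ {z ∈ U | sInf (f '' U) + δ < f z ∧ f z < f x₀},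
      ∀ b ∈ {z ∈ U | sInf (f '' U) + δ < f z ∧ f z < f x₀},
        ‖∇ f b - ∇ f a‖ ^ 2 ≤ M * ⟪b - a, ∇ f b - ∇ f a⟫_ℝ := by
  obtain ⟨V, g, hV, -, hVU, hlevV, hg, hgconv, hgf⟩ := hsm δ hδ
  obtain ⟨M, hM⟩ := exists_norm_gradient_sub_sq_le_of_isCompact hV hg hgconv hlev
    (hf.convex_le (f x₀)) hlevV
  have hgrad : ∀ a ∈ {z ∈ U | sInf (f '' U) + δ < f z ∧ f z < f x₀}, ∇ g a = ∇ f a :=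
    fun a ⟨haU, hα, hβ⟩ => gradient_eq_of_eqOn_levels hV ((hf.continuousOn hU).mono hVU)
      (fun z hz => hgf z (hVU hz)) (hlevV ⟨haU, hβ.le⟩) hα hβ
  refine ⟨M, fun a ha b hb => ?_⟩
  rw [← hgrad a ha, ← hgrad b hb]
  exact hM a ⟨ha.1, ha.2.2.le⟩ b ⟨hb.1, hb.2.2.le⟩

namespace IsBFGSSequence

variable {x : ℕ → EuclideanSpace ℝ (Fin n)}

theorem exists_isWolfeRun (hx : IsBFGSSequence f x) :
    ∃ μ > 0, ∃ ν H, IsWolfeRun ν H (fun k => ∇ f (x k)) (fun k => x (k + 1) - x k) ∧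
      ∀ k, f (x (k + 1)) ≤ f (x k) + μ * ⟪∇ f (x k), x (k + 1) - x k⟫_ℝ := by
  obtain ⟨hgrad, μ, ν, H₀, hμ, -, hν, hH₀, hstep⟩ := hx
  exact ⟨μ, hμ, ν, hessInv f x H₀, ⟨hν, hH₀, fun _ => rfl, fun k => (hgrad k).2,
    fun k => (hstep k).1, fun k => (hstep k).2.2⟩, fun k => (hstep k).2.1⟩

theorem strictAnti (hx : IsBFGSSequence f x) : StrictAnti fun k => f (x k) := by
  obtain ⟨μ, hμ, ν, H, hrun, harmijo⟩ := hx.exists_isWolfeRun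
  exact strictAnti_nat_of_succ_lt fun k => (harmijo k).trans_lt
    (add_lt_of_neg_right _ (mul_neg_of_pos_of_neg hμ (hrun.inner_neg k)))

theorem frequently_norm_gradient_lt (hx : IsBFGSSequence f x)
    (hbdd : BddBelow (Set.range fun k => f (x k))) {M : ℝ}
    (hM : ∀ᶠ k in atTop, ‖∇ f (x (k + 1)) - ∇ f (x k)‖ ^ 2 ≤
      M * ⟪x (k + 1) - x k, ∇ f (x (k + 1)) - ∇ f (x k)⟫_ℝ) {c : ℝ} (hc : 0 < c) :
    ∃ᶠ k in atTop, ‖∇ f (x k)‖ < c := by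
  obtain ⟨μ, hμ, ν, H, hrun, harmijo⟩ := hx.exists_isWolfeRun
  exact hrun.frequently_norm_lt
    (tendsto_zero_of_sufficient_decrease hbdd hμ (fun k => (hrun.inner_neg k).le) harmijo) hM hc

theorem exists_lt_sInf_add (hx : IsBFGSSequence f x) (hxU : ∀ k, x k ∈ U) (hU : IsOpen U)
    (hf : ConvexOn ℝ U f) (hlev : IsCompact {z ∈ U | f z ≤ f (x 0)})
    (hsm : SmoothConvexAbove U f (x 0)) {ε : ℝ} (hε : 0 < ε) :
    ∃ k, f (x k) < sInf (f '' U) + ε := by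
  by_contra! hfar
  have hleast :=
    isLeast_sInf_image_of_isCompact_sublevel (hf.continuousOn hU) (hxU 0) hlev
  obtain ⟨z, hzU, hz⟩ := hleast.1
  have hbdd : BddBelow (Set.range fun k => f (x k)) :=
    ⟨_, Set.forall_mem_range.2 fun k => hleast.2 ⟨x k, hxU k, rfl⟩⟩
  obtain ⟨M, hM⟩ := hsm.exists_norm_gradient_sub_sq_le hU hf hlev (half_pos hε)
  have hmem : ∀ k, 0 < k →
      x k ∈ {w ∈ U | sInf (f '' U) + ε / 2 < f w ∧ f w < f (x 0)} := fun k hk =>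
    ⟨hxU k, by linarith [hfar k], hx.strictAnti hk⟩
  have hcoc : ∀ᶠ k in atTop, ‖∇ f (x (k + 1)) - ∇ f (x k)‖ ^ 2 ≤
      M * ⟪x (k + 1) - x k, ∇ f (x (k + 1)) - ∇ f (x k)⟫_ℝ :=
    (eventually_gt_atTop 0).mono fun k hk => hM _ (hmem k hk) _ (hmem (k + 1) k.succ_pos)
  obtain ⟨D, hD, hlevD⟩ := hlev.isBounded.subset_closedBall_lt 0 z
  obtain ⟨k, hk⟩ := (hx.frequently_norm_gradient_lt hbdd hcoc (div_pos hε hD)).exists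
  have hdist : dist (x k) z ≤ D := hlevD ⟨hxU k, hx.strictAnti.antitone k.zero_le⟩
  have hgap : f (x k) - f z < ε := calc
    _ ≤ ‖∇ f (x k)‖ * dist (x k) z :=
      sub_le_norm_gradient_mul_dist_of_convexOn hf (hxU k) hzU (hx.1 k).1
    _ ≤ ‖∇ f (x k)‖ * D := by gcongr
    _ < ε := (lt_div_iff₀ hD).1 hk
  linarith [hfar k]

theorem isGLB_range (hx : IsBFGSSequence f x) (hxU : ∀ k, x k ∈ U) (hU : IsOpen U)
    (hf : ConvexOn ℝ U f) (hlev : IsCompact {z ∈ U | f z ≤ f (x 0)})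
    (hsm : SmoothConvexAbove U f (x 0)) :
    IsGLB (Set.range fun k => f (x k)) (sInf (f '' U)) := by
  have hleast :=
    isLeast_sInf_image_of_isCompact_sublevel (hf.continuousOn hU) (hxU 0) hlev
  refine ⟨Set.forall_mem_range.2 fun k => hleast.2 ⟨x k, hxU k, rfl⟩, fun b hb => ?_⟩
  refine le_of_forall_pos_le_add fun ε hε => ?_
  obtain ⟨k, hk⟩ := hx.exists_lt_sInf_add hxU hU hf hlev hsm hε
  exact (hb ⟨k, rfl⟩).trans hk.le

end IsBFGSSequence

end BFGSSequence

end BFGS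

theorem theorem3 {n : ℕ} (U : Set (EuclideanSpace ℝ (Fin n))) (hUo : IsOpen U)
    (hUc : Convex ℝ U) (f : EuclideanSpace ℝ (Fin n) → ℝ) (hf : ConvexOn ℝ U f)
    (x : ℕ → EuclideanSpace ℝ (Fin n)) (hxU : ∀ k, x k ∈ U) (hx : BFGS.IsBFGSSequence f x)
    (hlev : IsCompact {z ∈ U | f z ≤ f (x 0)}) :
    (ContDiffOn ℝ 2 f U → BFGS.SmoothConvexAbove U f (x 0)) ∧
    (BFGS.SmoothConvexAbove U f (x 0) →
      IsLeast (f '' U) (sInf (f '' U)) ∧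
      Tendsto (fun k => f (x k)) atTop (𝓝 (sInf (f '' U)))) := by
  refine ⟨fun hsmooth δ _ => ?_, fun hsm => ⟨?_, ?_⟩⟩
  · exact ⟨U, f, hUo, hUc, subset_rfl, Set.sep_subset _ _, hsmooth, hf, fun _ _ _ _ => rfl⟩
  · exact BFGS.isLeast_sInf_image_of_isCompact_sublevel (hf.continuousOn hUo) (hxU 0) hlev
  · exact tendsto_atTop_isGLB hx.strictAnti.antitone (hx.isGLB_range hxU hUo hf hlev hsm)
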